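/- Let $\mathbb{D}^*=\{z\in\mathbb{C}:0<|z|<1\}$ be the punctured unit disc, let $\lambda^*(z)=-1/(|z|\log|z|)$ be its hyperbolic density, and let $\rho^*$ be the hyperbolic metric on $\mathbb{D}^*$ that it gives rise to, that is, $\rho^*(z,w)=\inf_\gamma\int_\gamma\lambda^*(\zeta)\,|d\zeta|$, where the infimum is taken over all continuously differentiable paths $\gamma$ in $\mathbb{D}^*$ from $z$ to $w$. The degree of a holomorphic map $f\colon\mathbb{D}^*\to\mathbb{D}^*$ is \[ \deg(f)=\frac{1}{2\pi i}\int_{|z|=1/2}\frac{f'(z)}{f(z)}\,dz, \] where the circle is traversed once counterclockwise. Suppose that $f$ is a holomorphic self-map of $\mathbb{D}^*$ with $\deg(f)=1$, and that $a,z\in\mathbb{D}^*$. Then \[ \rho^*(f(z),z)\leq L^3\rho^*(f(a),a),\qquad\text{where } L=8\lambda^*(a)\exp\rho^*(z,a). \] -/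

import Mathlib

noncomputable section

namespace PuncturedDisc

/-- The punctured unit disc `𝔻* = {z : 0 < |z| < 1}`. -/
def Dstar : Set ℂ := Metric.ball (0 : ℂ) 1 \ {0}

/-- The hyperbolic density `λ*(z) = -1 / (|z| log |z|)` of the punctured disc (curvature `-1`). -/
def lambdaStar (z : ℂ) : ℝ := -1 / (‖z‖ * Real.log ‖z‖)

/-- `γ` restricted to `[0, 1]` is a continuously differentiable path in `𝔻*` from `z` to `w`. -/
structure IsPath (γ : ℝ → ℂ) (z w : ℂ) : Prop where
  contDiffOn : ContDiffOn ℝ 1 γ (Set.Icc 0 1)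
  mapsTo : Set.MapsTo γ (Set.Icc 0 1) Dstar
  source : γ 0 = z
  target : γ 1 = w

/-- The hyperbolic length `∫_γ λ*(ζ) |dζ|` of a path `γ : [0, 1] → 𝔻*`. -/
def hypLength (γ : ℝ → ℂ) : ℝ :=
  ∫ t in (0 : ℝ)..1, lambdaStar (γ t) * ‖derivWithin γ (Set.Icc 0 1) t‖

/-- The hyperbolic distance `ρ*(z, w)` on `𝔻*`: the infimum of the hyperbolic lengths of the
continuously differentiable paths in `𝔻*` from `z` to `w`. -/
def rhoStar (z w : ℂ) : ℝ := sInf {l : ℝ | ∃ γ : ℝ → ℂ, IsPath γ z w ∧ hypLength γ = l}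

/-- `f` is a holomorphic self-map of `𝔻*`; the values of `f` off `𝔻*` are irrelevant. -/
structure IsHolSelfMap (f : ℂ → ℂ) : Prop where
  differentiableOn : DifferentiableOn ℂ f Dstar
  mapsTo : Set.MapsTo f Dstar Dstar

/-- The degree `(1 / 2πi) ∫ f'(z) / f(z) dz` of a holomorphic self-map `f` of `𝔻*`, the integral
being taken over the circle `|z| = 1/2` once counterclockwise (a nonnegative integer, as an
element of `ℂ`). -/
def degree (f : ℂ → ℂ) : ℂ :=
  (2 * Real.pi * Complex.I)⁻¹ * ∮ z in C(0, 1 / 2), deriv f z / f z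

end PuncturedDisc

end

/-!
A holomorphic self-map `f` of the punctured disc of degree one extends to the disc with a simple
zero at the origin and no other zeros, so `f z = z * exp (h z)` with `h` holomorphic on the whole
disc (`IsHolSelfMap.exists_eq_mul_exp`), and the Schwarz lemma gives `Re h ≤ 0`. In the logarithmic
coordinate `u = log z`, which turns `λ* |dz|` into the metric `|du| / |Re u|` of the left
half-plane, `f` is the translation of `u` by `h z`. Hence the displacement `ρ*(f z, z)` is governed
by the ratio of `|h z|` to `-log |z|`, and this for every branch of `h` modulo `2πi`:

* A path of length `l` from `f a` to `a` lifts to the half-plane, and a Grönwall argument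
  (`norm_sub_le_of_norm_deriv_le'`, `IsPath.exists_lift`) gives `|h a| ≤ -log |a| * (e ^ l - 1)`
  for the branch of `h` singled out by the lift.
* Conversely, an explicit arc (`bentArc`) shows
  `ρ*(f z, z) ≤ 8 log (1 + |h z| / (-log |z|))` for any branch (`hypLength_bentArc_le`).
* Along a path of length `r` from `z` to `a`, the quantity `-log |·|` changes at most by the
  factor `e ^ r`, and `|h|` at most by `e ^ (2 r)`, by the Schwarz lemma for maps to the half-plane
  (`norm_le_exp_mul_norm`).

Bernoulli's inequality `1 + c (e ^ l - 1) ≤ e ^ (c l)`, with `c = e ^ (3 r)`, combines these into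
`ρ*(f z, z) ≤ 8 e ^ (3 r) l` (`rhoStar_le_exp_mul_hypLength`). Taking the infimum over both paths
yields the theorem, since `λ* ≥ 1`.
-/

open Set Filter Topology Metric

namespace PuncturedDisc

/-! ### A Grönwall estimate in the left half-plane -/

/-- A curve in the left half-plane whose Euclidean speed is at most `s'` times the distance to the
imaginary axis moves by at most `e ^ (s 1 - s 0) - 1` times the initial such distance: first
Grönwall controls the growth of `-Re φ`, then the speed is integrated. -/
lemma norm_sub_le_of_norm_deriv_le {φ φ' : ℝ → ℂ} {s s' : ℝ → ℝ}
    (hφ : ∀ t ∈ Icc (0 : ℝ) 1, HasDerivWithinAt φ (φ' t) (Icc 0 1) t)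
    (hs : ∀ t ∈ Icc (0 : ℝ) 1, HasDerivWithinAt s (s' t) (Icc 0 1) t)
    (hs' : ∀ t ∈ Icc (0 : ℝ) 1, 0 ≤ s' t)
    (hb : ∀ t ∈ Icc (0 : ℝ) 1, ‖φ' t‖ ≤ s' t * -(φ t).re) :
    ‖φ 1 - φ 0‖ ≤ -(φ 0).re * (Real.exp (s 1 - s 0) - 1) := by
  have hmono : AntitoneOn (fun t => -(φ t).re * Real.exp (-(s t - s 0))) (Icc 0 1) := by
    have hd : ∀ t ∈ Icc (0 : ℝ) 1,
        HasDerivWithinAt (fun t => -(φ t).re * Real.exp (-(s t - s 0)))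
          (-(φ' t).re * Real.exp (-(s t - s 0)) +
            -(φ t).re * (Real.exp (-(s t - s 0)) * -s' t)) (Icc 0 1) t := by
      intro t ht
      have h1 : HasDerivWithinAt (fun t => (φ t).re) (φ' t).re (Icc 0 1) t :=
        Complex.reCLM.hasFDerivAt.comp_hasDerivWithinAt t (hφ t ht)
      exact h1.fun_neg.fun_mul (((hs t ht).sub_const (s 0)).fun_neg.exp)
    refine antitoneOn_of_hasDerivWithinAt_nonpos (convex_Icc 0 1)
      (fun t ht => (hd t ht).continuousWithinAt)
      (fun t ht => (hd t (interior_subset ht)).mono interior_subset) ?_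
    intro t ht
    have ht' := interior_subset ht
    have h2 : -(φ' t).re ≤ ‖φ' t‖ := (neg_le_abs _).trans (Complex.abs_re_le_norm _)
    have h3 := hb t ht'
    have h4 := Real.exp_pos (-(s t - s 0))
    have : (-(φ' t).re - s' t * -(φ t).re) * Real.exp (-(s t - s 0)) ≤ 0 :=
      mul_nonpos_of_nonpos_of_nonneg (by linarith) h4.le
    linarith
  have hR : ∀ t ∈ Icc (0 : ℝ) 1, -(φ t).re ≤ -(φ 0).re * Real.exp (s t - s 0) := by
    intro t ht
    have h1 := hmono (left_mem_Icc.2 zero_le_one) ht ht.1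
    simp only [sub_self, neg_zero, Real.exp_zero, mul_one] at h1
    rw [Real.exp_neg] at h1
    have h4 := Real.exp_pos (s t - s 0)
    calc -(φ t).re = -(φ t).re * (Real.exp (s t - s 0))⁻¹ * Real.exp (s t - s 0) := by
          field_simp
      _ ≤ _ := by gcongr
  have hIci : ∀ t ∈ Ico (0 : ℝ) 1, Icc (0 : ℝ) 1 ∈ 𝓝[Ici t] t := fun t ht =>
    mem_of_superset (Icc_mem_nhdsGE ht.2) (Icc_subset_Icc_left ht.1)
  refine image_norm_le_of_norm_deriv_right_le_deriv_boundary' (f := fun t => φ t - φ 0)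
    (f' := φ') (B := fun t => -(φ 0).re * (Real.exp (s t - s 0) - 1))
    (B' := fun t => -(φ 0).re * (Real.exp (s t - s 0) * s' t)) (a := 0) (b := 1)
    (fun t ht => (hφ t ht).continuousWithinAt.sub_const _) ?_ (by simp) ?_ ?_ ?_
    (right_mem_Icc.2 zero_le_one)
  · intro t ht
    exact ((hφ t (Ico_subset_Icc_self ht)).mono_of_mem_nhdsWithin (hIci t ht)).sub_const _
  · intro t ht
    exact ((((hs t ht).sub_const (s 0)).exp.sub_const 1).const_mul _).continuousWithinAt
  · intro t ht
    exact ((((hs t (Ico_subset_Icc_self ht)).mono_of_mem_nhdsWithin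
      (hIci t ht)).sub_const (s 0)).exp.sub_const 1).const_mul _
  · intro t ht
    have ht' := Ico_subset_Icc_self ht
    calc ‖φ' t‖ ≤ s' t * -(φ t).re := hb t ht'
      _ ≤ s' t * (-(φ 0).re * Real.exp (s t - s 0)) :=
        mul_le_mul_of_nonneg_left (hR t ht') (hs' t ht')
      _ = _ := by ring

/-- The estimate of `norm_sub_le_of_norm_deriv_le` based at the endpoint of the curve. -/
lemma norm_sub_le_of_norm_deriv_le' {φ φ' : ℝ → ℂ} {s s' : ℝ → ℝ}
    (hφ : ∀ t ∈ Icc (0 : ℝ) 1, HasDerivWithinAt φ (φ' t) (Icc 0 1) t)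
    (hs : ∀ t ∈ Icc (0 : ℝ) 1, HasDerivWithinAt s (s' t) (Icc 0 1) t)
    (hs' : ∀ t ∈ Icc (0 : ℝ) 1, 0 ≤ s' t)
    (hb : ∀ t ∈ Icc (0 : ℝ) 1, ‖φ' t‖ ≤ s' t * -(φ t).re) :
    ‖φ 0 - φ 1‖ ≤ -(φ 1).re * (Real.exp (s 1 - s 0) - 1) := by
  have hm : MapsTo (fun t : ℝ => 1 - t) (Icc 0 1) (Icc 0 1) := fun t ht =>
    ⟨by linarith [ht.2], by linarith [ht.1]⟩
  have hd : ∀ t ∈ Icc (0 : ℝ) 1, HasDerivWithinAt (fun t : ℝ => 1 - t) (-1) (Icc 0 1) t :=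
    fun t _ => ((hasDerivAt_id t).const_sub 1).hasDerivWithinAt
  have := norm_sub_le_of_norm_deriv_le (φ := fun t => φ (1 - t)) (φ' := fun t => -φ' (1 - t))
    (s := fun t => -s (1 - t)) (s' := fun t => s' (1 - t)) ?_ ?_ (fun t ht => hs' _ (hm ht)) ?_
  · simpa [sub_eq_neg_add, add_comm] using this
  · intro t ht
    simpa [Function.comp_def] using! HasDerivWithinAt.scomp t (hφ _ (hm ht)) (hd t ht) hm
  · intro t ht
    simpa using (HasDerivWithinAt.scomp t (hs _ (hm ht)) (hd t ht) hm).fun_neg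
  · intro t ht
    simpa using hb _ (hm ht)

/-! ### Lengths of paths in the punctured disc -/

lemma norm_pos_of_mem {z : ℂ} (hz : z ∈ Dstar) : 0 < ‖z‖ := norm_pos_iff.2 hz.2

lemma norm_lt_one_of_mem {z : ℂ} (hz : z ∈ Dstar) : ‖z‖ < 1 := by
  simpa using hz.1

lemma log_norm_neg {z : ℂ} (hz : z ∈ Dstar) : Real.log ‖z‖ < 0 :=
  Real.log_neg (norm_pos_of_mem hz) (norm_lt_one_of_mem hz)

lemma lambdaStar_eq (z : ℂ) : lambdaStar z = (‖z‖ * -Real.log ‖z‖)⁻¹ := by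
  rw [lambdaStar, mul_neg, inv_neg, neg_div, one_div]

lemma lambdaStar_pos {z : ℂ} (hz : z ∈ Dstar) : 0 < lambdaStar z := by
  rw [lambdaStar_eq]
  have := log_norm_neg hz
  have := norm_pos_of_mem hz
  exact inv_pos.2 (mul_pos this (by linarith))

/-- `λ* ≥ 1`, because `r log (1 / r) ≤ 1 - r`. -/
lemma one_le_lambdaStar {z : ℂ} (hz : z ∈ Dstar) : 1 ≤ lambdaStar z := by
  have h0 := norm_pos_of_mem hz
  have h1 := log_norm_neg hz
  rw [lambdaStar_eq, one_le_inv₀ (mul_pos h0 (by linarith))]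
  have h2 := Real.one_sub_inv_le_log_of_pos h0
  have h3 : ‖z‖ * -Real.log ‖z‖ ≤ ‖z‖ * (‖z‖⁻¹ - 1) := by gcongr; linarith
  have h4 : ‖z‖ * (‖z‖⁻¹ - 1) = 1 - ‖z‖ := by field_simp
  linarith

lemma continuousOn_lambdaStar : ContinuousOn lambdaStar Dstar := by
  unfold lambdaStar
  refine continuousOn_const.div (continuous_norm.continuousOn.mul
    (continuous_norm.continuousOn.log fun z hz => (norm_pos_of_mem hz).ne')) fun z hz => ?_
  exact mul_ne_zero (norm_pos_of_mem hz).ne' (log_norm_neg hz).ne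

namespace IsPath

variable {γ : ℝ → ℂ} {z w : ℂ}

lemma hasDerivWithinAt (h : IsPath γ z w) {t : ℝ} (ht : t ∈ Icc (0 : ℝ) 1) :
    HasDerivWithinAt γ (derivWithin γ (Icc 0 1) t) (Icc 0 1) t :=
  ((h.contDiffOn.differentiableOn one_ne_zero) t ht).hasDerivWithinAt

lemma continuousOn_derivWithin (h : IsPath γ z w) :
    ContinuousOn (derivWithin γ (Icc 0 1)) (Icc 0 1) :=
  h.contDiffOn.continuousOn_derivWithin (uniqueDiffOn_Icc zero_lt_one) le_rfl

lemma continuousOn_speed (h : IsPath γ z w) :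
    ContinuousOn (fun t => lambdaStar (γ t) * ‖derivWithin γ (Icc 0 1) t‖) (Icc 0 1) :=
  (continuousOn_lambdaStar.comp h.contDiffOn.continuousOn h.mapsTo).mul
    h.continuousOn_derivWithin.norm

lemma speed_nonneg (h : IsPath γ z w) {t : ℝ} (ht : t ∈ Icc (0 : ℝ) 1) :
    0 ≤ lambdaStar (γ t) * ‖derivWithin γ (Icc 0 1) t‖ :=
  mul_nonneg (lambdaStar_pos (h.mapsTo ht)).le (norm_nonneg _)

lemma hypLength_nonneg (h : IsPath γ z w) : 0 ≤ hypLength γ :=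
  intervalIntegral.integral_nonneg zero_le_one fun _ ht => h.speed_nonneg ht

end IsPath

/-- A continuous function on `[0, 1]` has a primitive there. -/
lemma exists_primitive_Icc {E : Type*} [NormedAddCommGroup E] [NormedSpace ℝ E] [CompleteSpace E]
    {g : ℝ → E} (hg : ContinuousOn g (Icc 0 1)) :
    ∃ G : ℝ → E, G 0 = 0 ∧ G 1 = ∫ t in (0 : ℝ)..1, g t ∧
      ∀ t ∈ Icc (0 : ℝ) 1, HasDerivWithinAt G (g t) (Icc 0 1) t := by
  have hc : Continuous (IccExtend (zero_le_one (α := ℝ)) ((Icc (0 : ℝ) 1).domRestrict g)) :=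
    (continuousOn_iff_continuous_domRestrict.1 hg).Icc_extend'
  have he : ∀ t ∈ Icc (0 : ℝ) 1, IccExtend (zero_le_one (α := ℝ)) ((Icc (0 : ℝ) 1).domRestrict g) t
      = g t := fun t ht => by rw [IccExtend_of_mem _ _ ht]; rfl
  refine ⟨fun x => ∫ t in (0 : ℝ)..x, IccExtend (zero_le_one (α := ℝ))
    ((Icc (0 : ℝ) 1).domRestrict g) t, by simp, ?_, fun t ht => ?_⟩
  · refine intervalIntegral.integral_congr fun t ht => he t ?_
    rwa [uIcc_of_le zero_le_one] at ht
  · rw [← he t ht]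
    exact (hc.integral_hasStrictDerivAt 0 t).hasDerivAt.hasDerivWithinAt

/-- Every path in the punctured disc lifts through `exp` to the left half-plane, where the
hyperbolic density becomes `1 / |Re|`; the Grönwall estimate then compares the displacement of the
lift with the length of the path. -/
lemma IsPath.exists_lift {γ : ℝ → ℂ} {z w : ℂ} (h : IsPath γ z w) :
    ∃ u v : ℂ, Complex.exp u = z ∧ Complex.exp v = w ∧
      ‖v - u‖ ≤ -u.re * (Real.exp (hypLength γ) - 1) ∧
      ‖u - v‖ ≤ -v.re * (Real.exp (hypLength γ) - 1) := by
  obtain ⟨s, hs0, hs1, hs⟩ := exists_primitive_Icc h.continuousOn_speed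
  have hne : ∀ t ∈ Icc (0 : ℝ) 1, γ t ≠ 0 := fun t ht => (h.mapsTo ht).2
  obtain ⟨U, hU0, -, hU⟩ := exists_primitive_Icc
    (h.continuousOn_derivWithin.div h.contDiffOn.continuousOn hne)
  set u : ℝ → ℂ := fun t => Complex.log z + U t with hu
  have hz : z ∈ Dstar := h.source ▸ h.mapsTo (left_mem_Icc.2 zero_le_one)
  have hexp : ∀ t ∈ Icc (0 : ℝ) 1, Complex.exp (u t) = γ t := by
    have hd : ∀ t ∈ Icc (0 : ℝ) 1,
        HasDerivWithinAt (fun t => γ t * Complex.exp (-u t)) 0 (Icc 0 1) t := by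
      intro t ht
      have := (h.hasDerivWithinAt ht).fun_mul ((((hU t ht).const_add (Complex.log z)).fun_neg).cexp)
      convert! this using 1
      have := hne t ht
      simp only [Pi.div_apply]
      field_simp
      simp
    intro t ht
    have h1 : γ t * Complex.exp (-u t) = γ 0 * Complex.exp (-u 0) := by
      refine constant_of_derivWithin_zero (fun t ht => (hd t ht).differentiableWithinAt)
        (fun t ht => (hd t (Ico_subset_Icc_self ht)).derivWithin
          (uniqueDiffOn_Icc zero_lt_one t (Ico_subset_Icc_self ht))) t ht
    rw [h.source] at h1
    simp only [hu, hU0, add_zero, Complex.exp_neg, Complex.exp_log hz.2] at h1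
    rw [mul_inv_cancel₀ hz.2] at h1
    exact (mul_inv_eq_one₀ (Complex.exp_ne_zero _)).1 h1 |>.symm
  have hre : ∀ t ∈ Icc (0 : ℝ) 1, (u t).re = Real.log ‖γ t‖ := by
    intro t ht
    rw [← hexp t ht, Complex.norm_exp, Real.log_exp]
  have hud : ∀ t ∈ Icc (0 : ℝ) 1, HasDerivWithinAt u _ (Icc 0 1) t := fun t ht =>
    (hU t ht).const_add (Complex.log z)
  have hb : ∀ t ∈ Icc (0 : ℝ) 1, ‖derivWithin γ (Icc 0 1) t / γ t‖ ≤
      lambdaStar (γ t) * ‖derivWithin γ (Icc 0 1) t‖ * -(u t).re := by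
    intro t ht
    have h1 := log_norm_neg (h.mapsTo ht)
    have h2 := norm_pos_of_mem (h.mapsTo ht)
    rw [hre t ht, lambdaStar_eq, norm_div]
    apply le_of_eq
    have := h1.ne
    field_simp
  have hsl : s 1 - s 0 = hypLength γ := by rw [hs1, hs0, sub_zero]; rfl
  refine ⟨u 0, u 1, ?_, ?_, ?_, ?_⟩
  · rw [hexp 0 (left_mem_Icc.2 zero_le_one), h.source]
  · rw [hexp 1 (right_mem_Icc.2 zero_le_one), h.target]
  · rw [← hsl]
    exact norm_sub_le_of_norm_deriv_le hud hs (fun t ht => h.speed_nonneg ht) hb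
  · rw [← hsl]
    exact norm_sub_le_of_norm_deriv_le' hud hs (fun t ht => h.speed_nonneg ht) hb

/-! ### Self-maps of degree one -/

/-- A zero-free holomorphic function on a disc has a holomorphic logarithm. -/
lemma exists_eq_exp_of_ne_zero {G : ℂ → ℂ} {c : ℂ} {R : ℝ} (hR : 0 < R)
    (hG : DifferentiableOn ℂ G (ball c R)) (h0 : ∀ z ∈ ball c R, G z ≠ 0) :
    ∃ h : ℂ → ℂ, DifferentiableOn ℂ h (ball c R) ∧ ∀ z ∈ ball c R, G z = Complex.exp (h z) := by
  obtain ⟨h, hc, hd⟩ := (((hG.deriv isOpen_ball).div hG h0).isExactOn_ball).with_val_at c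
    (Complex.log (G c))
  have hcb : c ∈ ball c R := mem_ball_self hR
  refine ⟨h, fun z hz => (hd z hz).differentiableAt.differentiableWithinAt, fun z hz => ?_⟩
  have hder : ∀ z ∈ ball c R, HasDerivAt (fun z => G z * Complex.exp (-h z)) 0 z := by
    intro z hz
    have h1 := ((hG.differentiableAt (isOpen_ball.mem_nhds hz)).hasDerivAt).fun_mul
      (hd z hz).fun_neg.cexp
    convert! h1 using 1
    have := h0 z hz
    simp only [Pi.div_apply]
    field_simp
    simp
  have h1 : G z * Complex.exp (-h z) = G c * Complex.exp (-h c) :=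
    isOpen_ball.is_const_of_deriv_eq_zero (convex_ball c R).isPreconnected
      (fun z hz => (hder z hz).differentiableAt.differentiableWithinAt)
      (fun z hz => (hder z hz).deriv) hz hcb
  rw [hc, Complex.exp_neg, Complex.exp_neg, Complex.exp_log (h0 c hcb),
    mul_inv_cancel₀ (h0 c hcb)] at h1
  exact (mul_inv_eq_one₀ (Complex.exp_ne_zero _)).1 h1

lemma isOpen_Dstar : IsOpen Dstar := isOpen_ball.sdiff isClosed_singleton

/-- A holomorphic self-map of the punctured disc has a removable singularity at the origin;
dividing by the zero there leaves a zero-free function on the disc, hence an exponential. -/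
lemma IsHolSelfMap.exists_eq_pow_mul_exp {f : ℂ → ℂ} (hf : IsHolSelfMap f) :
    ∃ (n : ℕ) (h : ℂ → ℂ), DifferentiableOn ℂ h (ball 0 1) ∧
      ∀ z ∈ Dstar, f z = z ^ n * Complex.exp (h z) := by
  have hnhds : ball (0 : ℂ) 1 ∈ 𝓝 0 := ball_mem_nhds 0 one_pos
  obtain ⟨F, hFd, hFf⟩ : ∃ F : ℂ → ℂ, DifferentiableOn ℂ F (ball 0 1) ∧
      ∀ z ≠ 0, F z = f z := by
    refine ⟨_, Complex.differentiableOn_update_limUnder_of_bddAbove hnhds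
      hf.differentiableOn ⟨1, ?_⟩, fun z hz => Function.update_of_ne hz _ _⟩
    rintro _ ⟨z, hz, rfl⟩
    exact (norm_lt_one_of_mem (hf.mapsTo hz)).le
  have hD : ∀ᶠ z in 𝓝[≠] (0 : ℂ), z ∈ Dstar := by
    filter_upwards [self_mem_nhdsWithin, mem_nhdsWithin_of_mem_nhds hnhds] with z h1 h2
    exact ⟨h2, h1⟩
  obtain ⟨n, g, hg, hg0, hFg⟩ :=
    (hFd.analyticAt hnhds).exists_eventuallyEq_pow_smul_nonzero_iff.2 (by
      intro hz
      obtain ⟨z, h1, h2⟩ := ((hz.filter_mono nhdsWithin_le_nhds).and hD).exists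
      rw [hFf z h2.2] at h1
      exact (hf.mapsTo h2).2 h1)
  set G : ℂ → ℂ := Function.update (fun z => f z / z ^ n) 0 (g 0) with hG
  have hGne : ∀ z ≠ 0, G z = f z / z ^ n := fun z hz => Function.update_of_ne hz _ _
  have hG0 : G 0 = g 0 := Function.update_self ..
  have hGg : G =ᶠ[𝓝 0] g := by
    filter_upwards [hFg] with z hz
    rcases eq_or_ne z 0 with rfl | hz0
    · exact hG0
    · rw [hGne z hz0, ← hFf z hz0, hz, sub_zero, smul_eq_mul,
        mul_div_cancel_left₀ _ (pow_ne_zero n hz0)]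
  have hGd : DifferentiableOn ℂ G (ball 0 1) := by
    intro z hz
    refine DifferentiableAt.differentiableWithinAt ?_
    rcases eq_or_ne z 0 with rfl | hz0
    · exact hGg.differentiableAt_iff.2 hg.differentiableAt
    · have hev : G =ᶠ[𝓝 z] fun z => f z / z ^ n := by
        filter_upwards [isOpen_ne.mem_nhds hz0] with w hw using hGne w hw
      refine hev.differentiableAt_iff.2 (DifferentiableAt.fun_div ?_ (by fun_prop)
        (pow_ne_zero n hz0))
      exact hf.differentiableOn.differentiableAt (isOpen_Dstar.mem_nhds ⟨hz, hz0⟩)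
  obtain ⟨h, hh, hexp⟩ := exists_eq_exp_of_ne_zero one_pos hGd (fun z hz => by
    rcases eq_or_ne z 0 with rfl | hz0
    · rwa [hG0]
    · rw [hGne z hz0]
      exact div_ne_zero (hf.mapsTo ⟨hz, hz0⟩).2 (pow_ne_zero n hz0))
  refine ⟨n, h, hh, fun z hz => ?_⟩
  rw [← hexp z hz.1, hGne z hz.2, mul_div_cancel₀ _ (pow_ne_zero n hz.2)]

/-- The degree of `z ^ n * e ^ h` is `n`: its logarithmic derivative is `n / z + h'`, and `h'` has
a primitive. -/
lemma degree_eq_of_eq_pow_mul_exp {f h : ℂ → ℂ} {n : ℕ} (hh : DifferentiableOn ℂ h (ball 0 1))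
    (hfh : ∀ z ∈ Dstar, f z = z ^ n * Complex.exp (h z)) : degree f = n := by
  have hsub : sphere (0 : ℂ) (1 / 2) ⊆ Dstar := by
    intro z hz
    have hz' : ‖z‖ = 1 / 2 := by simpa using hz
    refine ⟨by rw [mem_ball_zero_iff, hz']; norm_num, ?_⟩
    rintro rfl
    norm_num at hz'
  have hhd : ∀ z ∈ Dstar, HasDerivAt h (deriv h z) z := fun z hz =>
    (hh.differentiableAt (isOpen_ball.mem_nhds hz.1)).hasDerivAt
  have hlog : ∀ z ∈ sphere (0 : ℂ) (1 / 2),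
      deriv f z / f z = (n : ℂ) * (z - 0)⁻¹ + deriv h z := by
    intro z hz
    have hzD := hsub hz
    have hev : f =ᶠ[𝓝 z] fun z => z ^ n * Complex.exp (h z) := by
      filter_upwards [isOpen_Dstar.mem_nhds hzD] with w hw using hfh w hw
    have hz0 : z ≠ 0 := hzD.2
    have hexp := Complex.exp_ne_zero (h z)
    rw [hev.deriv_eq, hfh z hzD, ((hasDerivAt_pow n z).fun_mul (hhd z hzD).cexp).deriv]
    rcases n with _ | n
    · simp
    · simp only [Nat.add_sub_cancel]
      field_simp
      push_cast
      ring
  have hci : ∀ c : ℂ, CircleIntegrable (fun z => c * (z - 0)⁻¹) 0 (1 / 2) := fun c =>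
    (ContinuousOn.mul continuousOn_const (ContinuousOn.inv₀ (by fun_prop)
      fun z hz => by simpa using (hsub hz).2)).circleIntegrable (by norm_num)
  have hch : CircleIntegrable (deriv h) 0 (1 / 2) :=
    ((hh.deriv isOpen_ball).continuousOn.mono fun z hz => (hsub hz).1).circleIntegrable
      (by norm_num)
  rw [degree, circleIntegral.integral_congr (by norm_num) hlog,
    circleIntegral.integral_add (hci n) hch, circleIntegral.integral_const_mul,
    circleIntegral.integral_sub_center_inv 0 (by norm_num),
    circleIntegral.integral_eq_zero_of_hasDerivWithinAt (by norm_num)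
      fun z hz => (hhd z (hsub hz)).hasDerivWithinAt]
  have := Complex.two_pi_I_ne_zero
  field_simp
  simp

/-- A self-map of degree one is `z * e ^ h` with `h` holomorphic on the whole disc; by the Schwarz
lemma `h` takes its values in the closed left half-plane. -/
lemma IsHolSelfMap.exists_eq_mul_exp {f : ℂ → ℂ} (hf : IsHolSelfMap f) (hdeg : degree f = 1) :
    ∃ h : ℂ → ℂ, DifferentiableOn ℂ h (ball 0 1) ∧ (∀ z ∈ Dstar, (h z).re ≤ 0) ∧
      ∀ z ∈ Dstar, f z = z * Complex.exp (h z) := by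
  obtain ⟨n, h, hh, hfh⟩ := hf.exists_eq_pow_mul_exp
  obtain rfl : n = 1 := by
    rw [degree_eq_of_eq_pow_mul_exp hh hfh] at hdeg
    exact_mod_cast hdeg
  simp only [pow_one] at hfh
  refine ⟨h, hh, fun z hz => ?_, hfh⟩
  have hS : ‖z * Complex.exp (h z)‖ ≤ ‖z‖ := by
    refine Complex.norm_le_norm_of_mapsTo_ball (f := fun z => z * Complex.exp (h z)) (R := 1)
      (by fun_prop) (fun w hw => ?_) (by simp) (norm_lt_one_of_mem hz)
    rcases eq_or_ne w 0 with rfl | hw0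
    · simp
    · change w * Complex.exp (h w) ∈ _
      rw [← hfh w ⟨hw, hw0⟩]
      exact ball_subset_closedBall (hf.mapsTo ⟨hw, hw0⟩).1
  rw [norm_mul, Complex.norm_exp] at hS
  have := (mul_le_iff_le_one_right (norm_pos_of_mem hz)).1 hS
  simpa using this

/-! ### The Schwarz–Pick estimate for maps to the left half-plane -/

/-- The Schwarz lemma for a map from a disc to the closed left half-plane, at the centre. -/
lemma norm_deriv_le_of_re_nonpos {H : ℂ → ℂ} {c : ℂ} {R : ℝ} (hR : 0 < R)
    (hH : DifferentiableOn ℂ H (ball c R)) (hre : ∀ z ∈ ball c R, (H z).re ≤ 0) :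
    ‖deriv H c‖ ≤ 2 * -(H c).re / R := by
  have hc : c ∈ ball c R := mem_ball_self hR
  rw [le_div_iff₀ hR]
  refine le_of_forall_pos_le_add fun ε hε => ?_
  -- `K` is `H` shifted into the open half-plane, followed by the Cayley transform vanishing at
  -- `p`, the shifted value at the centre.
  set p : ℂ := H c - (ε / 2 : ℝ) with hp
  have hpre : p.re = (H c).re - ε / 2 := by simp [hp]
  have hden : ∀ z ∈ ball c R, 0 < ‖H z - (ε / 2 : ℝ) + starRingEnd ℂ p‖ := by
    intro z hz
    refine norm_pos_iff.2 fun h0 => ?_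
    have := congrArg Complex.re h0
    simp [hpre] at this
    linarith [hre z hz, hre c hc]
  have hHd : HasDerivAt H (deriv H c) c :=
    (hH.differentiableAt (isOpen_ball.mem_nhds hc)).hasDerivAt
  have hpp : p + starRingEnd ℂ p = ((2 * p.re : ℝ) : ℂ) := by rw [Complex.add_conj]
  have hq : (0 : ℝ) < -(2 * p.re) := by rw [hpre]; linarith [hre c hc]
  set K : ℂ → ℂ := fun z => (H z - (ε / 2 : ℝ) - p) / (H z - (ε / 2 : ℝ) + starRingEnd ℂ p)
    with hK
  have hK0 : K c = 0 := by simp [hK, hp]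
  have hKd : HasDerivAt K (deriv H c / ((2 * p.re : ℝ) : ℂ)) c := by
    have h1 := ((hHd.sub_const ((ε / 2 : ℝ) : ℂ)).sub_const p).fun_div
      ((hHd.sub_const ((ε / 2 : ℝ) : ℂ)).add_const (starRingEnd ℂ p))
      (norm_pos_iff.1 (hden c hc))
    convert! h1 using 1
    rw [← hp, hpp, sub_self, zero_mul, sub_zero]
    have : ((2 * p.re : ℝ) : ℂ) ≠ 0 := by exact_mod_cast (by linarith : (2 * p.re : ℝ) ≠ 0)
    field_simp
  have hS := Complex.norm_deriv_le_div_of_mapsTo_ball (f := K) (R₂ := 1)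
    (DifferentiableOn.fun_div (by fun_prop) (by fun_prop)
      fun z hz => norm_pos_iff.1 (hden z hz)) (fun z hz => ?_) hR
  · rw [hKd.deriv, norm_div, Complex.norm_real, Real.norm_eq_abs, ← abs_neg, abs_of_pos hq,
      div_le_div_iff₀ hq hR, one_mul, hpre] at hS
    linarith
  · rw [hK0, mem_closedBall_zero_iff]
    rw [hK]
    simp only [norm_div]
    rw [div_le_one (hden z hz)]
    rw [← sq_le_sq₀ (norm_nonneg _) (norm_nonneg _), Complex.sq_norm, Complex.sq_norm,
      Complex.normSq_apply, Complex.normSq_apply]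
    simp only [Complex.sub_re, Complex.add_re, Complex.sub_im, Complex.add_im, Complex.conj_re,
      Complex.conj_im, Complex.ofReal_re, Complex.ofReal_im, sub_zero]
    nlinarith [mul_nonneg (by linarith : (0 : ℝ) ≤ -(2 * p.re))
      (by linarith [hre z hz] : (0 : ℝ) ≤ -((H z).re - ε / 2))]

/-- The Schwarz–Pick estimate with respect to the density of the punctured disc, obtained by
pulling back to the left half-plane through `exp`, in which the disc about `log z` of radius
`-log |z|` lies. -/
lemma norm_deriv_le_lambdaStar {h : ℂ → ℂ} (hh : DifferentiableOn ℂ h Dstar)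
    (hre : ∀ z ∈ Dstar, (h z).re ≤ 0) {z : ℂ} (hz : z ∈ Dstar) :
    ‖deriv h z‖ ≤ 2 * lambdaStar z * -(h z).re := by
  have hlog := log_norm_neg hz
  have hz0 := norm_pos_of_mem hz
  have hm : MapsTo Complex.exp (ball (Complex.log z) (-Real.log ‖z‖)) Dstar := by
    intro w hw
    refine ⟨?_, Complex.exp_ne_zero w⟩
    rw [mem_ball_zero_iff, Complex.norm_exp, Real.exp_lt_one_iff]
    have h1 : (w - Complex.log z).re < -Real.log ‖z‖ :=
      (Complex.re_le_norm _).trans_lt (by simpa [dist_eq_norm] using hw)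
    rw [Complex.sub_re, Complex.log_re] at h1
    linarith
  have hexp : Complex.exp (Complex.log z) = z := Complex.exp_log hz.2
  have hS := norm_deriv_le_of_re_nonpos (H := fun w => h (Complex.exp w)) (by linarith)
    (hh.comp Complex.differentiable_exp.differentiableOn hm) fun w hw => hre _ (hm hw)
  have hd : HasDerivAt (fun w => h (Complex.exp w)) (deriv h z * z) (Complex.log z) := by
    have h1 : HasDerivAt h (deriv h z) (Complex.exp (Complex.log z)) := by
      rw [hexp]
      exact (hh.differentiableAt (isOpen_Dstar.mem_nhds hz)).hasDerivAt
    have h2 := h1.comp (Complex.log z) (Complex.hasDerivAt_exp _)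
    rwa [hexp] at h2
  rw [hd.deriv, hexp, norm_mul, ← le_div_iff₀ hz0] at hS
  refine hS.trans (le_of_eq ?_)
  rw [lambdaStar_eq]
  have := hlog.ne
  field_simp

/-- A Harnack estimate: along a path of length `r` a holomorphic function with values in the closed
left half-plane grows in norm by at most the factor `e ^ (2 r)`. -/
lemma norm_le_exp_mul_norm {h : ℂ → ℂ} (hh : DifferentiableOn ℂ h Dstar)
    (hre : ∀ z ∈ Dstar, (h z).re ≤ 0) {γ : ℝ → ℂ} {z a : ℂ} (hγ : IsPath γ z a) :
    ‖h z‖ ≤ Real.exp (2 * hypLength γ) * ‖h a‖ := by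
  obtain ⟨s, hs0, hs1, hs⟩ := exists_primitive_Icc hγ.continuousOn_speed
  have h1 := norm_sub_le_of_norm_deriv_le' (φ := fun t => h (γ t)) (s := fun t => 2 * s t)
    (φ' := fun t => derivWithin γ (Icc 0 1) t * deriv h (γ t))
    (fun t ht => (hh.differentiableAt
      (isOpen_Dstar.mem_nhds (hγ.mapsTo ht))).hasDerivAt.scomp_hasDerivWithinAt t
        (hγ.hasDerivWithinAt ht)) (fun t ht => (hs t ht).const_mul 2)
    (fun t ht => mul_nonneg zero_le_two (hγ.speed_nonneg ht)) (fun t ht => by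
      rw [norm_mul]
      have := mul_le_mul_of_nonneg_left (norm_deriv_le_lambdaStar hh hre (hγ.mapsTo ht))
        (norm_nonneg (derivWithin γ (Icc 0 1) t))
      linarith)
  simp only [hγ.source, hγ.target, hs0, hs1, mul_zero, sub_zero] at h1
  change ‖h z - h a‖ ≤ -(h a).re * (Real.exp (2 * hypLength γ) - 1) at h1
  have h2 : 0 ≤ Real.exp (2 * hypLength γ) - 1 := by
    have := Real.add_one_le_exp (2 * hypLength γ)
    linarith [hγ.hypLength_nonneg]
  have h3 : -(h a).re ≤ ‖h a‖ := (neg_le_abs _).trans (Complex.abs_re_le_norm _)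
  have h4 := mul_le_mul_of_nonneg_right h3 h2
  have h5 := norm_le_norm_sub_add (h z) (h a)
  linarith

/-! ### An explicit path -/

/-- The image under `exp` of an arc in the left half-plane from `u + w` to `u`, bent away from the
imaginary axis by the height `t (1 - t) ‖w‖`. The bend makes the hyperbolic length of the arc
logarithmic, rather than linear, in `‖w‖`. -/
noncomputable def bentArc (u w : ℂ) (t : ℝ) : ℂ :=
  Complex.exp (u + (1 - t) * w - t * (1 - t) * ‖w‖)

lemma norm_bentArc (u w : ℂ) (t : ℝ) :
    ‖bentArc u w t‖ = Real.exp (-(-u.re + (1 - t) * -w.re + t * (1 - t) * ‖w‖)) := by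
  rw [bentArc, Complex.norm_exp]
  congr 1
  have : u + (1 - t) * w - t * (1 - t) * ‖w‖ =
    u + ((1 - t : ℝ) : ℂ) * w - ((t * (1 - t) * ‖w‖ : ℝ) : ℂ) := by push_cast; ring
  rw [this, Complex.sub_re, Complex.add_re, Complex.re_ofReal_mul, Complex.ofReal_re]
  ring

lemma isPath_bentArc {u w : ℂ} (hu : u.re < 0) (huw : (u + w).re < 0) :
    IsPath (bentArc u w) (Complex.exp (u + w)) (Complex.exp u) where
  contDiffOn := by
    have h : ContDiff ℝ 1 (fun t : ℝ => (t : ℂ)) := Complex.ofRealCLM.contDiff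
    refine ContDiff.contDiffOn (ContDiff.cexp ?_)
    exact (contDiff_const.add ((contDiff_const.sub h).mul contDiff_const)).sub
      ((h.mul (contDiff_const.sub h)).mul contDiff_const)
  mapsTo := by
    rintro t ⟨h0, h1⟩
    refine ⟨?_, Complex.exp_ne_zero _⟩
    rw [mem_ball_zero_iff, norm_bentArc, Real.exp_lt_one_iff]
    rw [Complex.add_re] at huw
    have h2 : 0 ≤ t * (1 - t) * ‖w‖ :=
      mul_nonneg (mul_nonneg h0 (by linarith)) (norm_nonneg w)
    have h3 : 0 < -u.re + (1 - t) * -w.re := by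
      rcases h0.eq_or_lt with rfl | h0
      · linarith
      · nlinarith
    linarith
  source := by simp [bentArc]
  target := by simp [bentArc]

lemma derivWithin_bentArc (u w : ℂ) {t : ℝ} (ht : t ∈ Icc (0 : ℝ) 1) :
    derivWithin (bentArc u w) (Icc 0 1) t = bentArc u w t * (-w - (1 - 2 * t) * ‖w‖) := by
  have h : HasDerivAt (fun t : ℝ => (t : ℂ)) 1 t := Complex.ofRealCLM.hasDerivAt
  have h1 := ((((h.const_sub 1).mul_const w).const_add u).fun_sub
    ((h.fun_mul (h.const_sub 1)).mul_const (‖w‖ : ℂ))).cexp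
  have h2 : HasDerivAt (bentArc u w) (bentArc u w t * (-w - (1 - 2 * t) * ‖w‖)) t := by
    convert! h1 using 1
    rw [bentArc]
    ring
  exact h2.hasDerivWithinAt.derivWithin (uniqueDiffOn_Icc zero_lt_one t ht)

lemma exists_isPath {p q : ℂ} (hp : p ∈ Dstar) (hq : q ∈ Dstar) : ∃ γ, IsPath γ p q := by
  refine ⟨bentArc (Complex.log q) (Complex.log p - Complex.log q), ?_⟩
  have h := isPath_bentArc (u := Complex.log q) (w := Complex.log p - Complex.log q)
    (by rw [Complex.log_re]; exact log_norm_neg hq)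
    (by rw [add_sub_cancel, Complex.log_re]; exact log_norm_neg hp)
  rwa [add_sub_cancel, Complex.exp_log hp.2, Complex.exp_log hq.2] at h

lemma rhoStar_le_hypLength {γ : ℝ → ℂ} {z w : ℂ} (h : IsPath γ z w) :
    rhoStar z w ≤ hypLength γ :=
  csInf_le ⟨0, by rintro _ ⟨γ, hγ, rfl⟩; exact hγ.hypLength_nonneg⟩ ⟨γ, h, rfl⟩

lemma hypLength_bentArc_le {u w : ℂ} (hu : u.re < 0) (hw : w.re ≤ 0) :
    hypLength (bentArc u w) ≤ 8 * Real.log (1 + ‖w‖ / -u.re) := by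
  have hpath := isPath_bentArc hu (by rw [Complex.add_re]; linarith : (u + w).re < 0)
  set y : ℝ := -u.re with hy
  set N : ℝ := ‖w‖ with hN
  have hypos : 0 < y := by linarith
  have hN0 : 0 ≤ N := norm_nonneg w
  have hA : ∀ t : ℝ, 0 ≤ t → 0 < y + t * (N / 2) := fun t ht => by positivity
  -- Since `t (1 - t) ≥ min t (1 - t) / 2`, the speed is bounded by the derivative of `Φ`.
  set Φ : ℝ → ℝ := fun t => 4 * Real.log (y + t * (N / 2)) - 4 * Real.log (y + (1 - t) * (N / 2))
  have hΦ : ∀ t ∈ Icc (0 : ℝ) 1, HasDerivAt Φ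
      (4 * ((N / 2) / (y + t * (N / 2))) + 4 * ((N / 2) / (y + (1 - t) * (N / 2)))) t := by
    intro t ht
    have h1 : HasDerivAt (fun t : ℝ => y + t * (N / 2)) (N / 2) t := by
      simpa using ((hasDerivAt_id t).mul_const (N / 2)).const_add y
    have h2 : HasDerivAt (fun t : ℝ => y + (1 - t) * (N / 2)) (-(N / 2)) t := by
      simpa using (((hasDerivAt_id t).const_sub 1).mul_const (N / 2)).const_add y
    have h3 := ((h1.log (hA t ht.1).ne').const_mul 4).fun_sub
      ((h2.log (hA (1 - t) (by linarith [ht.2])).ne').const_mul 4)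
    convert! h3 using 1
    ring
  have hint : hypLength (bentArc u w) ≤ Φ 1 - Φ 0 := by
    refine intervalIntegral.integral_le_sub_of_hasDeriv_right_of_le zero_le_one
      (fun t ht => (hΦ t ht).continuousAt.continuousWithinAt)
      (fun t ht => (hΦ t (Ioo_subset_Icc_self ht)).hasDerivWithinAt)
      hpath.continuousOn_speed.integrableOn_Icc ?_
    rintro t ⟨h0, h1⟩
    rw [derivWithin_bentArc u w ⟨h0.le, h1.le⟩, norm_mul, ← mul_assoc]
    set D : ℝ := y + (1 - t) * -w.re + t * (1 - t) * N with hD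
    have hDy : y + t * (1 - t) * N ≤ D := by
      have : 0 ≤ (1 - t) * -w.re := mul_nonneg (by linarith) (by linarith)
      linarith
    have htt : 0 < t * (1 - t) := mul_pos h0 (by linarith)
    have hE : 0 < y + t * (1 - t) * N := by positivity
    have hDpos : 0 < D := hE.trans_le hDy
    have hlam : lambdaStar (bentArc u w t) * ‖bentArc u w t‖ = D⁻¹ := by
      have hnorm : ‖bentArc u w t‖ = Real.exp (-D) := norm_bentArc u w t
      rw [lambdaStar_eq, hnorm, Real.log_exp, neg_neg]
      have := Real.exp_pos (-D)
      field_simp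
    have hnum : ‖-w - (1 - 2 * t) * N‖ ≤ 2 * N := by
      have h2 : ‖((1 - 2 * t : ℝ) : ℂ) * (N : ℂ)‖ ≤ N := by
        rw [norm_mul, Complex.norm_real, Complex.norm_real, Real.norm_eq_abs, Real.norm_eq_abs,
          abs_of_nonneg hN0]
        have : |1 - 2 * t| ≤ 1 := abs_le.2 ⟨by linarith, by linarith⟩
        nlinarith
      have h3 := norm_sub_le (-w) (((1 - 2 * t : ℝ) : ℂ) * (N : ℂ))
      rw [norm_neg] at h3
      push_cast at h2 h3
      linarith
    rw [hlam]
    have hmin : ∀ r : ℝ, r ≤ 2 * (t * (1 - t)) → 0 ≤ r →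
        2 * N / (y + t * (1 - t) * N) ≤ 4 * ((N / 2) / (y + r * (N / 2))) := by
      intro r hr hr0
      have hB := hA r hr0
      rw [show 4 * ((N / 2) / (y + r * (N / 2))) = 2 * N / (y + r * (N / 2)) by ring]
      refine div_le_div_of_nonneg_left (by positivity) hB ?_
      linarith [mul_le_mul_of_nonneg_right hr (by positivity : 0 ≤ N / 2)]
    have hp1 : 0 ≤ 4 * ((N / 2) / (y + t * (N / 2))) := by
      have := hA t h0.le
      positivity
    have hp2 : 0 ≤ 4 * ((N / 2) / (y + (1 - t) * (N / 2))) := by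
      have := hA (1 - t) (by linarith)
      positivity
    calc D⁻¹ * ‖-w - (1 - 2 * t) * N‖ ≤ (y + t * (1 - t) * N)⁻¹ * (2 * N) := by gcongr
      _ = 2 * N / (y + t * (1 - t) * N) := by ring
      _ ≤ _ := by
        rcases le_total t (1 / 2) with h | h
        · linarith [hmin t (by nlinarith) h0.le]
        · linarith [hmin (1 - t) (by nlinarith) (by linarith)]
  refine hint.trans ?_
  have h1 : Φ 1 - Φ 0 = 8 * (Real.log (y + N / 2) - Real.log y) := by
    simp only [Φ, sub_self, zero_mul, one_mul, add_zero, sub_zero]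
    ring
  rw [h1, ← Real.log_div (by positivity) (by positivity)]
  gcongr
  rw [add_div, div_self hypos.ne']
  gcongr
  linarith

/-! ### Comparison of the displacements at two points -/

/-- The comparison for two fixed paths. The lift of `η` singles out a branch of `h` whose value at
`a` is controlled by the length of `η`; this value is transported to `z` along `γ`, and the
displacement at `z` is bounded by the length of a bent arc. -/
lemma rhoStar_le_exp_mul_hypLength {f h : ℂ → ℂ} (hh : DifferentiableOn ℂ h Dstar)
    (hre : ∀ z ∈ Dstar, (h z).re ≤ 0) (hfh : ∀ z ∈ Dstar, f z = z * Complex.exp (h z))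
    {a z : ℂ} (ha : a ∈ Dstar) (hz : z ∈ Dstar) {γ η : ℝ → ℂ} (hγ : IsPath γ z a)
    (hη : IsPath η (f a) a) :
    rhoStar (f z) z ≤ 8 * Real.exp (3 * hypLength γ) * hypLength η := by
  set r := hypLength γ
  set l := hypLength η
  have hr : 0 ≤ r := hγ.hypLength_nonneg
  have hl : 0 ≤ l := hη.hypLength_nonneg
  obtain ⟨u, v, hu, hv, -, huv⟩ := hη.exists_lift
  obtain ⟨u', v', hu', hv', huv', -⟩ := hγ.exists_lift
  have hre_log : ∀ {b c : ℂ}, Complex.exp b = c → b.re = Real.log ‖c‖ := by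
    rintro b _ rfl
    rw [Complex.norm_exp, Real.log_exp]
  have hy0 : 0 < -v.re := by rw [hre_log hv]; linarith [log_norm_neg ha]
  have hy : 0 < -u'.re := by rw [hre_log hu']; linarith [log_norm_neg hz]
  have hy0y : -v.re ≤ Real.exp r * -u'.re := by
    have h1 : -(v' - u').re ≤ ‖v' - u'‖ := (neg_le_abs _).trans (Complex.abs_re_le_norm _)
    rw [Complex.sub_re] at h1
    rw [hre_log hv, ← hre_log hv']
    linarith
  -- Adding the period `δ` to `h` selects the branch that takes the value `u - v` at `a`.
  set δ : ℂ := u - v - h a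
  have hδ : Complex.exp δ = 1 := by
    rw [Complex.exp_sub, Complex.exp_sub, hu, hv, hfh a ha, mul_div_cancel_left₀ _ ha.2,
      div_self (Complex.exp_ne_zero _)]
  have hδre : δ.re = 0 := by rw [hre_log hδ, norm_one, Real.log_one]
  have hre' : ∀ x ∈ Dstar, (h x + δ).re ≤ 0 := fun x hx => by
    rw [Complex.add_re, hδre, add_zero]
    exact hre x hx
  have hHarnack := norm_le_exp_mul_norm (h := fun x => h x + δ) (hh.add_const δ) hre' hγ
  have hda : h a + δ = u - v := by simp [δ]
  simp only [hda] at hHarnack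
  have hratio : ‖h z + δ‖ / -u'.re ≤ Real.exp (3 * r) * (Real.exp l - 1) := by
    have hl' : 0 ≤ Real.exp l - 1 := by linarith [Real.add_one_le_exp l]
    rw [div_le_iff₀ hy]
    calc ‖h z + δ‖ ≤ Real.exp (2 * r) * ‖u - v‖ := hHarnack
      _ ≤ Real.exp (2 * r) * (-v.re * (Real.exp l - 1)) := by gcongr
      _ ≤ Real.exp (2 * r) * (Real.exp r * -u'.re * (Real.exp l - 1)) := by gcongr
      _ = Real.exp (3 * r) * (Real.exp l - 1) * -u'.re := by
        rw [show 3 * r = 2 * r + r by ring, Real.exp_add]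
        ring
  have hfz : Complex.exp (u' + (h z + δ)) = f z := by
    rw [Complex.exp_add, Complex.exp_add, hu', hδ, mul_one, hfh z hz]
  have hre_z := hre' z hz
  have hpath := isPath_bentArc (u := u') (w := h z + δ) (by linarith)
    (by rw [Complex.add_re]; linarith)
  rw [hfz, hu'] at hpath
  have hBernoulli : 1 + Real.exp (3 * r) * (Real.exp l - 1) ≤ Real.exp (Real.exp (3 * r) * l) := by
    have h1 := one_add_mul_self_le_rpow_one_add (s := Real.exp l - 1)
      (by linarith [Real.exp_pos l]) (Real.one_le_exp (by linarith : 0 ≤ 3 * r))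
    rwa [add_sub_cancel, ← Real.exp_mul, mul_comm l] at h1
  calc rhoStar (f z) z ≤ hypLength (bentArc u' (h z + δ)) := rhoStar_le_hypLength hpath
    _ ≤ 8 * Real.log (1 + ‖h z + δ‖ / -u'.re) := hypLength_bentArc_le (by linarith) hre_z
    _ ≤ 8 * Real.log (Real.exp (Real.exp (3 * r) * l)) := by
      gcongr
      linarith
    _ = 8 * Real.exp (3 * r) * l := by rw [Real.log_exp]; ring

end PuncturedDisc

theorem mainTheorem5 (f : ℂ → ℂ) (hf : PuncturedDisc.IsHolSelfMap f)
    (hdeg : PuncturedDisc.degree f = 1)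
    (a z : ℂ) (ha : a ∈ PuncturedDisc.Dstar) (hz : z ∈ PuncturedDisc.Dstar) :
    PuncturedDisc.rhoStar (f z) z ≤
      (8 * PuncturedDisc.lambdaStar a * Real.exp (PuncturedDisc.rhoStar z a)) ^ 3 *
        PuncturedDisc.rhoStar (f a) a := by
  open PuncturedDisc in
  obtain ⟨h, hh, hre, hfh⟩ := hf.exists_eq_mul_exp hdeg
  set L : ℝ := 8 * lambdaStar a * Real.exp (rhoStar z a) with hL
  have hL0 : 0 < L := mul_pos (mul_pos (by norm_num) (lambdaStar_pos ha)) (Real.exp_pos _)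
  -- Nearly shortest paths from `z` to `a` suffice, as `8 e ^ 3 ≤ 8 ^ 3`.
  obtain ⟨_, ⟨γ, hγ, rfl⟩, hlt⟩ := exists_lt_of_csInf_lt
    (s := {l : ℝ | ∃ γ : ℝ → ℂ, IsPath γ z a ∧ hypLength γ = l})
    (let ⟨γ, hγ⟩ := exists_isPath hz ha; ⟨_, γ, hγ, rfl⟩) (lt_add_one (rhoStar z a))
  have hconst : 8 * Real.exp (3 * hypLength γ) ≤ L ^ 3 := by
    have h1 : Real.exp (hypLength γ) ≤ 3 * Real.exp (rhoStar z a) := by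
      calc Real.exp (hypLength γ) ≤ Real.exp (1 + rhoStar z a) :=
            Real.exp_le_exp.2 (by linarith)
        _ = Real.exp 1 * Real.exp (rhoStar z a) := Real.exp_add _ _
        _ ≤ 3 * Real.exp (rhoStar z a) := by
          gcongr
          linarith [Real.exp_one_lt_d9]
    have h2 : 2 * Real.exp (hypLength γ) ≤ L := by
      have h3 : 8 * 1 * Real.exp (rhoStar z a) ≤ L := by
        rw [hL]
        gcongr
        exact one_le_lambdaStar ha
      linarith [Real.exp_pos (rhoStar z a)]
    calc 8 * Real.exp (3 * hypLength γ) = (2 * Real.exp (hypLength γ)) ^ 3 := by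
          rw [mul_pow, ← Real.exp_nat_mul]
          norm_num
      _ ≤ L ^ 3 := by gcongr
  rw [← div_le_iff₀' (by positivity)]
  refine le_csInf ?_ ?_
  · obtain ⟨η, hη⟩ := exists_isPath (hf.mapsTo ha) ha
    exact ⟨_, η, hη, rfl⟩
  · rintro _ ⟨η, hη, rfl⟩
    rw [div_le_iff₀' (by positivity)]
    refine (rhoStar_le_exp_mul_hypLength (hh.mono sdiff_subset) hre hfh ha hz hγ hη).trans ?_
    exact mul_le_mul_of_nonneg_right hconst hη.hypLength_nonneg
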